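/- For a finite simple graph $G$ with vertex set $V(G)$, let $$X_G=\sum_{\kappa}\ \prod_{v\in V(G)} x_{\kappa(v)}$$ be its chromatic symmetric function, a formal power series in $x_1,x_2,\dots$ over $\mathbb{Q}$, where $\kappa$ ranges over all maps $\kappa:V(G)\to\mathbb{Z}^{+}$ such that $\kappa(u)\neq\kappa(v)$ whenever $u$ and $v$ are adjacent. Let $\Lambda$ be the $\mathbb{Q}$-algebra of symmetric functions, i.e. of the formal power series of bounded degree in $x_1,x_2,\dots$ over $\mathbb{Q}$ that are invariant under all permutations of the variables, and for $n\ge 0$ let $\Lambda^n$ be the $\mathbb{Q}$-vector space of symmetric functions that are homogeneous of degree $n$ (together with $0$). For every $k\geq 1$ let $T_k$ be a tree with $k$ vertices. For a partition $\lambda=(\lambda_1,\dots,\lambda_\ell)$ let $T_\lambda=T_{\lambda_1}\sqcup\cdots\sqcup T_{\lambda_\ell}$ be the disjoint union. Then: 1. for every $n\ge 0$, the family $(X_{T_\lambda})_{\lambda\vdash n}$, indexed by the partitions of $n$, is a $\mathbb{Q}$-basis of $\Lambda^n$; 2. $\Lambda=\mathbb{Q}[X_{T_1},X_{T_2},\dots]$,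 i.e. $\Lambda$ is generated as a $\mathbb{Q}$-algebra by the $X_{T_k}$, $k\ge 1$; 3. the $X_{T_k}$, $k\geq 1$, are algebraically independent over $\mathbb{Q}$. -/

import Mathlib

noncomputable section

namespace ChromaticBases

/-- The content of a colouring `κ : V → ℤ⁺`: the exponent vector of the monomial
`∏ v, x_{κ v}`, whose value at a colour `i` is the number of vertices of colour `i`. -/
def content {V : Type*} [Fintype V] (κ : V → ℕ+) : ℕ+ →₀ ℕ :=
  ∑ v, Finsupp.single (κ v) 1

/-- Only finitely many proper colourings have a given content, so that the formal sum that defines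
the chromatic symmetric function makes sense. -/
theorem finite_coloring_content {V : Type*} [Fintype V] (G : SimpleGraph V) (d : ℕ+ →₀ ℕ) :
    Finite {κ : G.Coloring ℕ+ // content κ = d} := by
  classical
  have key : ∀ κ : {κ : G.Coloring ℕ+ // content κ = d}, ∀ v, κ.1 v ∈ d.support := by
    rintro ⟨κ, rfl⟩ v
    rw [Finsupp.mem_support_iff]
    intro h
    simp only [content, Finsupp.finsetSum_apply] at h
    have := (Finset.sum_eq_zero_iff.mp h) v (Finset.mem_univ v)
    simp at this
  refine Finite.of_injective
    (fun κ (v : V) => (⟨κ.1 v, key κ v⟩ : {i // i ∈ d.support})) ?_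
  intro κ κ' h
  apply Subtype.ext
  apply DFunLike.ext
  intro v
  exact congrArg Subtype.val (congrFun h v)

/-- The chromatic symmetric function `X_G = ∑_κ ∏_v x_{κ v}` of a finite simple graph, the sum
ranging over all proper colourings `κ : V → ℤ⁺`, as a formal power series in `x₁, x₂, …` over `ℚ`:
the coefficient of `x^d` is the number of proper colourings `κ` with `∏_v x_{κ v} = x^d`. -/
def csf {V : Type*} [Fintype V] (G : SimpleGraph V) : MvPowerSeries ℕ+ ℚ :=
  fun d => (Nat.card {κ : G.Coloring ℕ+ // content κ = d} : ℚ)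

/-- A formal power series in `x₁, x₂, …` is symmetric if every permutation of the variables
fixes it. -/
def IsSymm (f : MvPowerSeries ℕ+ ℚ) : Prop :=
  ∀ σ : Equiv.Perm ℕ+, MvPowerSeries.renameEquiv ℚ σ f = f

/-- The `ℚ`-algebra `Λ` of symmetric functions: symmetric formal power series of bounded degree in
the variables `x₁, x₂, …`. -/
def Lam : Subalgebra ℚ (MvPowerSeries ℕ+ ℚ) where
  carrier := {f | IsSymm f ∧ ∃ N : ℕ, ∀ d : ℕ+ →₀ ℕ, MvPowerSeries.coeff d f ≠ 0 → d.degree ≤ N}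
  mul_mem' := by
    classical
    rintro f g ⟨hf, N, hN⟩ ⟨hg, M, hM⟩
    refine ⟨fun σ => by rw [map_mul, hf σ, hg σ], N + M, fun d hd => ?_⟩
    rw [MvPowerSeries.coeff_mul] at hd
    obtain ⟨p, hp, hne⟩ := Finset.exists_ne_zero_of_sum_ne_zero hd
    rw [← Finset.HasAntidiagonal.mem_antidiagonal.mp hp, map_add]
    exact add_le_add (hN _ (left_ne_zero_of_mul hne)) (hM _ (right_ne_zero_of_mul hne))
  add_mem' := by
    rintro f g ⟨hf, N, hN⟩ ⟨hg, M, hM⟩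
    refine ⟨fun σ => by rw [map_add, hf σ, hg σ], max N M, fun d hd => ?_⟩
    rw [map_add] at hd
    by_cases h : MvPowerSeries.coeff d f = 0
    · exact (hM d fun h' => hd (by rw [h, h', add_zero])).trans (le_max_right _ _)
    · exact (hN d h).trans (le_max_left _ _)
  algebraMap_mem' := by
    classical
    intro r
    refine ⟨fun σ => AlgEquiv.commutes _ r, 0, fun d hd => ?_⟩
    rw [MvPowerSeries.algebraMap_apply, MvPowerSeries.coeff_C] at hd
    have : d = 0 := by
      by_contra h
      simp [h] at hd
    simp [this]

/-- The `ℚ`-vector space `Λⁿ` of homogeneous symmetric functions of degree `n` (with `0`). -/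
def LamDeg (n : ℕ) : Submodule ℚ (MvPowerSeries ℕ+ ℚ) where
  carrier := {f | IsSymm f ∧ f.IsHomogeneous n}
  add_mem' := by
    rintro f g ⟨hf, hf'⟩ ⟨hg, hg'⟩
    exact ⟨fun σ => by rw [map_add, hf σ, hg σ], hf'.add hg'⟩
  zero_mem' := ⟨fun σ => map_zero _, fun hd => absurd (map_zero _) hd⟩
  smul_mem' := by
    rintro c f ⟨hf, hf'⟩
    refine ⟨fun σ => by rw [map_smul, hf σ], fun hd => hf' fun h => hd ?_⟩
    rw [MvPowerSeries.coeff_smul, h, mul_zero]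

/-- The disjoint union `⨆ i, G i` of a family of graphs, on the disjoint union of the vertex
sets. -/
def disjointUnion {ι : Type*} {W : ι → Type*} (G : ∀ i, SimpleGraph (W i)) :
    SimpleGraph (Σ i, W i) :=
  ⨆ i, (G i).map (Function.Embedding.sigmaMk i)

theorem disjointUnion_adj {ι : Type*} {W : ι → Type*} (G : ∀ i, SimpleGraph (W i))
    (x y : Σ i, W i) :
    (disjointUnion G).Adj x y ↔
      ∃ (i : ι) (a b : W i), (G i).Adj a b ∧ x = ⟨i, a⟩ ∧ y = ⟨i, b⟩ := by
  simp [disjointUnion, SimpleGraph.iSup_adj, SimpleGraph.map_adj, eq_comm]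

/-- A part of a partition, as a positive integer. The type `p.parts.ToType` has one element for
each part of `p`, counted with multiplicity. -/
def part {n : ℕ} (p : n.Partition) (i : p.parts.ToType) : ℕ+ :=
  ⟨i.1, p.parts_pos (Multiset.coe_mem)⟩

/-- The graph `G_λ = G_{λ₁} ⊔ ⋯ ⊔ G_{λ_ℓ}` attached to a sequence of graphs `G₁, G₂, …` and a
partition `λ = (λ₁, …, λ_ℓ)`. -/
def partitionGraph {V : ℕ+ → Type*} (G : ∀ k, SimpleGraph (V k)) {n : ℕ} (p : n.Partition) :
    SimpleGraph (Σ i : p.parts.ToType, V (part p i)) :=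
  disjointUnion fun i => G (part p i)

end ChromaticBases

end

/-! Power sums are reached from trees by deletion–contraction. Ordinary chromatic symmetric
functions are not closed under contraction, so vertices carry weights: `weightedCsf`. For a leaf `v`
with neighbour `u`, colour `v` freely: either its colour differs from that of `u`, giving a
colouring of the tree, or it agrees, and `v` is absorbed into `u` with added weight. Hence p_{w(v)}
X_{T-v} = X_{T/uv} + X_T (`powerSum_mul_weightedCsf`). By induction, a tree of total weight m has
X_T = c p_m plus a polynomial in the p_j with j < m, where c ≠ 0 (`exists_weightedCsf_sub_mem`).
This triangular system can be inverted over ℚ, so the X_{T_k} generate the same algebra as the power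
sums.

That algebra is Λ. A symmetric function of degree n is determined by one coefficient per partition
of n, which bounds dim Λⁿ above; the power sums are algebraically independent, which gives the
matching lower bound and shows that their monomials span.

Finally, for homogeneous generators of Λ, one in each degree k ≥ 1, the monomials of degree n span
Λⁿ and are as many as its dimension. They therefore form a basis, and algebraic independence follows
(`algebraicIndependent_of_adjoin_eq`). Multiplicativity over disjoint unions identifies these
monomials with the X_{T_λ}. -/

noncomputable section

namespace ChromaticBases

open Finset

/-! ### Generating series of families of exponent vectors -/

/-- The generating series `∑ s, x ^ c s` of a family of exponent vectors. -/
def countSeries {S : Type*} (c : S → ℕ+ →₀ ℕ) : MvPowerSeries ℕ+ ℚ :=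
  fun d => (Nat.card {s // c s = d} : ℚ)

/-- Every exponent vector occurs only finitely often in the family. -/
def FiniteFibers {S : Type*} (c : S → ℕ+ →₀ ℕ) : Prop :=
  ∀ d, Finite {s // c s = d}

theorem coeff_countSeries {S : Type*} (c : S → ℕ+ →₀ ℕ) (d : ℕ+ →₀ ℕ) :
    MvPowerSeries.coeff d (countSeries c) = (Nat.card {s // c s = d} : ℚ) := rfl

theorem exists_of_coeff_countSeries_ne_zero {S : Type*} {c : S → ℕ+ →₀ ℕ} {d : ℕ+ →₀ ℕ}
    (h : MvPowerSeries.coeff d (countSeries c) ≠ 0) : ∃ s, c s = d := by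
  by_contra! h'
  have : IsEmpty {s // c s = d} := ⟨fun s => h' s.1 s.2⟩
  exact h (by simp [coeff_countSeries])

/-- Coefficients are cardinalities, so nothing cancels. Finiteness matters because `Nat.card` of an
infinite fibre is 0. -/
theorem coeff_countSeries_ne_zero {S : Type*} {c : S → ℕ+ →₀ ℕ} (hc : FiniteFibers c) (s : S) :
    MvPowerSeries.coeff (c s) (countSeries c) ≠ 0 := by
  have := hc (c s)
  have : Nonempty {t // c t = c s} := ⟨⟨s, rfl⟩⟩
  rw [coeff_countSeries]
  exact_mod_cast Nat.card_pos.ne'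

theorem FiniteFibers.comp {S S' : Type*} {c : S → ℕ+ →₀ ℕ} (hc : FiniteFibers c) {g : S' → S}
    (hg : Function.Injective g) : FiniteFibers (fun s => c (g s)) := fun d =>
  have := hc d
  Finite.of_injective (fun s : {s // c (g s) = d} => (⟨g s.1, s.2⟩ : {s // c s = d}))
    fun _ _ h => Subtype.ext (hg (congrArg Subtype.val h))

theorem countSeries_congr {S S' : Type*} {c : S → ℕ+ →₀ ℕ} {c' : S' → ℕ+ →₀ ℕ} (e : S ≃ S')
    (h : ∀ s, c' (e s) = c s) : countSeries c = countSeries c' := by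
  ext d
  rw [coeff_countSeries, coeff_countSeries,
    Nat.card_congr (e.subtypeEquiv (q := fun s => c' s = d) fun s => by rw [h])]

theorem countSeries_mul {S S' : Type*} {c : S → ℕ+ →₀ ℕ} {c' : S' → ℕ+ →₀ ℕ}
    (hc : FiniteFibers c) (hc' : FiniteFibers c') :
    countSeries c * countSeries c' = countSeries fun s : S × S' => c s.1 + c' s.2 := by
  classical
  ext d
  have := fun d => hc d
  have := fun d => hc' d
  -- Pairs are sorted by the exponents of their two members: one summand of the sigma type for each
  -- term of the Cauchy product.
  let e : {s : S × S' // c s.1 + c' s.2 = d} ≃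
      Σ q : antidiagonal d, {s // c s = q.1.1} × {s // c' s = q.1.2} :=
    { toFun := fun s => ⟨⟨(c s.1.1, c' s.1.2), mem_antidiagonal.2 s.2⟩, ⟨s.1.1, rfl⟩, ⟨s.1.2, rfl⟩⟩
      invFun := fun q => ⟨(q.2.1.1, q.2.2.1), by
        rw [q.2.1.2, q.2.2.2]; exact mem_antidiagonal.1 q.1.2⟩
      left_inv := fun s => rfl
      right_inv := by
        rintro ⟨⟨⟨q, q'⟩, hq⟩, ⟨s, hs⟩, ⟨s', hs'⟩⟩
        dsimp only at hs hs'
        subst hs hs'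
        rfl }
  rw [MvPowerSeries.coeff_mul, coeff_countSeries, Nat.card_congr e, Nat.card_sigma]
  simp only [coeff_countSeries, Nat.card_prod]
  rw [← sum_coe_sort]
  push_cast
  rfl

theorem countSeries_pi {ι : Type*} [Fintype ι] {S : ι → Type*} {c : ∀ i, S i → ℕ+ →₀ ℕ}
    (hc : ∀ i, FiniteFibers (c i)) :
    ∏ i, countSeries (c i) = countSeries fun s : ∀ i, S i => ∑ i, c i (s i) := by
  classical
  ext d
  have := fun i d => hc i d
  let e : {s : ∀ i, S i // ∑ i, c i (s i) = d} ≃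
      Σ q : finsuppAntidiag (univ : Finset ι) d, ∀ i, {s // c i s = q.1 i} :=
    { toFun := fun s => ⟨⟨Finsupp.equivFunOnFinite.symm fun i => c i (s.1 i), by
        simpa [mem_finsuppAntidiag] using s.2⟩, fun i => ⟨s.1 i, by simp⟩⟩
      invFun := fun q => ⟨fun i => (q.2 i).1, by
        exact (sum_congr rfl fun i _ => (q.2 i).2).trans (mem_finsuppAntidiag.1 q.1.2).1⟩
      left_inv := fun s => rfl
      right_inv := by
        rintro ⟨⟨q, hq⟩, s⟩
        obtain ⟨t, ht, rfl⟩ : ∃ (t : ∀ i, S i) (ht : ∀ i, c i (t i) = q i),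
            s = fun i => ⟨t i, ht i⟩ := ⟨fun i => (s i).1, fun i => (s i).2, rfl⟩
        obtain rfl : q = Finsupp.equivFunOnFinite.symm fun i => c i (t i) := by
          ext1 i
          exact (ht i).symm
        rfl }
  rw [MvPowerSeries.coeff_prod, coeff_countSeries, Nat.card_congr e, Nat.card_sigma]
  simp only [coeff_countSeries, Nat.card_pi]
  rw [← sum_coe_sort]
  push_cast
  rfl

theorem countSeries_split {S : Type*} {c : S → ℕ+ →₀ ℕ} (hc : FiniteFibers c) (p : S → Prop) :
    countSeries c =
      countSeries (fun s : {s // p s} => c s) + countSeries (fun s : {s // ¬ p s} => c s) := by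
  classical
  ext d
  have := hc d
  have := hc.comp (g := (Subtype.val : {s // p s} → S)) Subtype.val_injective d
  have := hc.comp (g := (Subtype.val : {s // ¬ p s} → S)) Subtype.val_injective d
  rw [map_add, coeff_countSeries, coeff_countSeries, coeff_countSeries,
    ← Nat.card_congr (Equiv.sumCompl fun s : {s // c s = d} => p s), Nat.card_sum, Nat.cast_add]
  congr 2
  · exact Nat.card_congr (Equiv.subtypeSubtypeEquivSubtypeInter _ _ |>.trans
      ((Equiv.subtypeEquivRight fun s => and_comm).trans
      (Equiv.subtypeSubtypeEquivSubtypeInter _ _).symm))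
  · exact Nat.card_congr (Equiv.subtypeSubtypeEquivSubtypeInter _ (fun s => ¬ p s) |>.trans
      ((Equiv.subtypeEquivRight fun s => and_comm).trans
      (Equiv.subtypeSubtypeEquivSubtypeInter (fun s => ¬ p s) (fun s => c s = d)).symm))

theorem isHomogeneous_countSeries {S : Type*} {c : S → ℕ+ →₀ ℕ} {n : ℕ}
    (h : ∀ s, (c s).degree = n) : (countSeries c).IsHomogeneous n := by
  intro d hd
  obtain ⟨s, rfl⟩ := exists_of_coeff_countSeries_ne_zero hd
  rw [← h s, Finsupp.degree_eq_weight_one]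
  rfl

theorem isSymm_iff {f : MvPowerSeries ℕ+ ℚ} :
    IsSymm f ↔ ∀ (σ : Equiv.Perm ℕ+) (d : ℕ+ →₀ ℕ),
      MvPowerSeries.coeff (d.mapDomain σ) f = MvPowerSeries.coeff d f := by
  have key (σ : Equiv.Perm ℕ+) (d : ℕ+ →₀ ℕ) :
      MvPowerSeries.coeff (d.mapDomain σ) (MvPowerSeries.renameEquiv ℚ σ f) =
        MvPowerSeries.coeff d f := by
    have := MvPowerSeries.coeff_embDomain_rename σ.toEmbedding f d
    rw [Finsupp.embDomain_eq_mapDomain] at this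
    exact this
  constructor
  · intro h σ d
    rw [← key σ d, h σ]
  · intro h σ
    ext d
    obtain ⟨d, rfl⟩ : ∃ d' : ℕ+ →₀ ℕ, d'.mapDomain σ = d :=
      ⟨d.mapDomain σ.symm, by rw [← Finsupp.mapDomain_comp]; simp⟩
    rw [key, h]

theorem isSymm_countSeries {S : Type*} {c : S → ℕ+ →₀ ℕ} (a : Equiv.Perm ℕ+ → S ≃ S)
    (h : ∀ σ s, c (a σ s) = (c s).mapDomain σ) : IsSymm (countSeries c) := by
  rw [isSymm_iff]
  intro σ d
  rw [coeff_countSeries, coeff_countSeries, ← Nat.card_congr ((a σ).subtypeEquiv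
    (p := fun s => c s = d) (q := fun s => c s = d.mapDomain σ) fun s => ?_)]
  rw [h]
  exact (Finsupp.mapDomain_injective (M := ℕ) σ.injective).eq_iff.symm

/-! ### Weighted contents and products of power sums -/

/-- The exponent vector of `∏ v, x_{κ v} ^ (w v)`. -/
def weightedContent {V : Type*} [Fintype V] (w : V → ℕ+) (κ : V → ℕ+) : ℕ+ →₀ ℕ :=
  ∑ v, Finsupp.single (κ v) (w v : ℕ)

theorem weightedContent_apply {V : Type*} [Fintype V] (w : V → ℕ+) (κ : V → ℕ+) (i : ℕ+) :
    weightedContent w κ i = ∑ v, if κ v = i then (w v : ℕ) else 0 := by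
  simp [weightedContent, Finsupp.finsetSum_apply, Finsupp.single_apply]

theorem mem_support_weightedContent {V : Type*} [Fintype V] {w : V → ℕ+} {κ : V → ℕ+} {i : ℕ+} :
    i ∈ (weightedContent w κ).support ↔ ∃ v, κ v = i := by
  rw [Finsupp.mem_support_iff, weightedContent_apply, Ne, sum_eq_zero_iff]
  simp

theorem finiteFibers_weightedContent {V : Type*} [Fintype V] (w : V → ℕ+) :
    FiniteFibers (weightedContent w) := by
  intro d
  refine Finite.of_injective
    (fun (κ : {κ // weightedContent w κ = d}) (v : V) => (⟨κ.1 v, ?_⟩ : {i // i ∈ d.support})) ?_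
  · obtain ⟨κ, rfl⟩ := κ
    exact mem_support_weightedContent.2 ⟨v, rfl⟩
  · intro κ κ' h
    exact Subtype.ext (funext fun v => congrArg Subtype.val (congrFun h v))

theorem weightedContent_one {V : Type*} [Fintype V] (κ : V → ℕ+) :
    weightedContent (fun _ => 1) κ = content κ := by
  simp [weightedContent, content]

/-- The power sum symmetric function `∑ i, x_i ^ k`. -/
def powerSum (k : ℕ+) : MvPowerSeries ℕ+ ℚ :=
  countSeries fun i : ℕ+ => Finsupp.single i (k : ℕ)

theorem finiteFibers_single (k : ℕ+) : FiniteFibers fun i : ℕ+ => Finsupp.single i (k : ℕ) := by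
  intro d
  have : Subsingleton {i : ℕ+ // Finsupp.single i (k : ℕ) = d} := by
    refine ⟨fun i j => Subtype.ext ?_⟩
    exact (Finsupp.single_left_inj k.ne_zero).1 (i.2.trans j.2.symm)
  infer_instance

theorem isHomogeneous_powerSum (k : ℕ+) : (powerSum k).IsHomogeneous k :=
  isHomogeneous_countSeries fun _ => Finsupp.degree_single _ _

theorem isSymm_powerSum (k : ℕ+) : IsSymm (powerSum k) :=
  isSymm_countSeries (fun σ => σ) fun _ _ => by rw [Finsupp.mapDomain_single]

theorem prod_powerSum {ι : Type*} [Fintype ι] (w : ι → ℕ+) :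
    ∏ i, powerSum (w i) = countSeries (weightedContent w) :=
  countSeries_pi fun i => finiteFibers_single (w i)

/-- An exponent vector is also a multiset of positive integers. This and `content_sigma` allow a
monomial to be treated as a product over an indexed family, which can then be expanded. -/
theorem prod_eq_prod_content {ι R : Type*} [Fintype ι] [CommRing R] (w : ι → ℕ+) (Y : ℕ+ → R) :
    ∏ i, Y (w i) = (content w).prod fun k n => Y k ^ n := by
  rw [content, ← Finsupp.prod_finsetSum_index (fun _ => pow_zero _) fun _ => pow_add _]
  simp

theorem degree_content {ι : Type*} [Fintype ι] (w : ι → ℕ+) :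
    (content w).degree = Fintype.card ι := by
  simp [content, map_sum]

theorem weight_content {ι : Type*} [Fintype ι] (w : ι → ℕ+) :
    Finsupp.weight (fun k : ℕ+ => (k : ℕ)) (content w) = ∑ i, (w i : ℕ) := by
  simp [content, map_sum, Finsupp.weight_single]

theorem content_congr {ι ι' : Type*} [Fintype ι] [Fintype ι'] {w : ι → ℕ+} {w' : ι' → ℕ+}
    (e : ι ≃ ι') (h : ∀ i, w' (e i) = w i) : content w = content w' :=
  Fintype.sum_equiv e _ _ fun i => by rw [h]

theorem content_sigma (s : ℕ+ →₀ ℕ) :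
    content (fun x : Σ k : s.support, Fin (s k) => (x.1 : ℕ+)) = s := by
  rw [content, Fintype.sum_sigma]
  simp only [sum_const, card_univ, Fintype.card_fin, Finsupp.smul_single, smul_eq_mul, mul_one]
  rw [sum_coe_sort s.support fun k => Finsupp.single k (s k)]
  exact s.sum_single

theorem content_apply {ι : Type*} [Fintype ι] (w : ι → ℕ+) (k : ℕ+) :
    content w k = Fintype.card {i // w i = k} := by
  classical
  simp [content, Finsupp.finsetSum_apply, Finsupp.single_apply, Fintype.card_subtype]

/-- The fibres of the two families over each `k` have equal size; bijections between them are glued.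
-/
theorem exists_equiv_of_content_eq {ι ι' : Type*} [Fintype ι] [Fintype ι'] {w : ι → ℕ+}
    {w' : ι' → ℕ+} (h : content w = content w') : ∃ e : ι ≃ ι', ∀ i, w' (e i) = w i := by
  have key (k : ℕ+) : Nonempty ({i // w i = k} ≃ {i // w' i = k}) :=
    Fintype.card_eq.1 (by rw [← content_apply, ← content_apply, h])
  let f := fun k => (key k).some
  refine ⟨(Equiv.sigmaFiberEquiv w).symm.trans
    ((Equiv.sigmaCongrRight f).trans (Equiv.sigmaFiberEquiv w')), fun i => ?_⟩
  exact (f (w i) ⟨i, rfl⟩).2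

/-! ### Exponent types and algebraic independence of the power sums -/

/-- The exponents of the monomial `x ^ d`, as a multiset: the value at `k` is the number of
variables that have exponent `k`. -/
def exponentType (d : ℕ+ →₀ ℕ) : ℕ+ →₀ ℕ :=
  content fun i : d.support => Nat.toPNat (d i) (Nat.pos_of_ne_zero (Finsupp.mem_support_iff.1 i.2))

/-- An injective `κ` merges no two weights, so it identifies `V` with the support and each exponent
is a single weight. -/
theorem exponentType_weightedContent {V : Type*} [Fintype V] (w : V → ℕ+) {κ : V → ℕ+}
    (hκ : Function.Injective κ) : exponentType (weightedContent w κ) = content w := by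
  let f : V → (weightedContent w κ).support :=
    fun v => ⟨κ v, mem_support_weightedContent.2 ⟨v, rfl⟩⟩
  have hf : Function.Bijective f := by
    refine ⟨fun _ _ h => hκ (congrArg Subtype.val h), fun i => ?_⟩
    obtain ⟨v, hv⟩ := mem_support_weightedContent.1 i.2
    exact ⟨v, Subtype.ext hv⟩
  refine (content_congr (Equiv.ofBijective f hf) fun v => ?_).symm
  apply PNat.coe_injective
  change weightedContent w κ (κ v) = w v
  classical
  rw [weightedContent_apply, sum_eq_single v (fun u _ h => if_neg (hκ.ne h)) (by simp), if_pos rfl]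

theorem weight_exponentType (d : ℕ+ →₀ ℕ) :
    Finsupp.weight (fun k : ℕ+ => (k : ℕ)) (exponentType d) = d.degree := by
  rw [exponentType, weight_content]
  exact sum_coe_sort d.support d

theorem degree_exponentType (d : ℕ+ →₀ ℕ) : (exponentType d).degree = d.support.card := by
  rw [exponentType, degree_content, Fintype.card_coe]

/-- A monomial whose exponents form the multiset `s`. -/
theorem exists_exponentType_eq_and_coeff_ne_zero (s : ℕ+ →₀ ℕ) :
    ∃ d, exponentType d = s ∧
      MvPowerSeries.coeff d (s.prod fun k n => powerSum k ^ n) ≠ 0 := by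
  -- Assigning distinct variables to the factors yields a monomial whose exponents are exactly the
  -- parts of `s`.
  obtain ⟨κ⟩ : Nonempty ((Σ k : s.support, Fin (s k)) ↪ ℕ+)  :=
    ⟨(Fintype.equivFin _).toEmbedding.trans
      (Fin.valEmbedding.trans Equiv.pnatEquivNat.symm.toEmbedding)⟩
  refine ⟨weightedContent (fun x => (x.1 : ℕ+)) κ, ?_, ?_⟩
  · rw [exponentType_weightedContent _ κ.injective, content_sigma]
  · conv in Finsupp.prod _ _ => rw [← content_sigma s]
    rw [← prod_eq_prod_content, prod_powerSum]
    exact coeff_countSeries_ne_zero (finiteFibers_weightedContent _) _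

/-- A monomial of a product of power sums arises by choosing a variable in each factor. The
variables used are at most as many as the factors, and equality forces the choice to be injective.
-/
theorem card_support_le_of_coeff_ne_zero {s d : ℕ+ →₀ ℕ}
    (h : MvPowerSeries.coeff d (s.prod fun k n => powerSum k ^ n) ≠ 0) :
    d.support.card ≤ s.degree ∧ (d.support.card = s.degree → exponentType d = s) := by
  classical
  obtain ⟨ι, hι, w, rfl⟩ : ∃ (ι : Type) (_ : Fintype ι) (w : ι → ℕ+), content w = s :=
    ⟨_, _, _, content_sigma s⟩
  rw [← prod_eq_prod_content, prod_powerSum] at h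
  obtain ⟨κ, rfl⟩ := exists_of_coeff_countSeries_ne_zero h
  have hs : (weightedContent w κ).support = univ.image κ := by
    ext i
    rw [mem_support_weightedContent]
    simp
  rw [hs, degree_content]
  refine ⟨card_image_le, fun h => exponentType_weightedContent w ?_⟩
  exact fun a b hab => card_image_iff.1 h (mem_coe.2 (mem_univ a)) (mem_coe.2 (mem_univ b)) hab

theorem aeval_eq_sum {R : Type*} [CommRing R] [Algebra ℚ R] (Y : ℕ+ → R)
    (P : MvPolynomial ℕ+ ℚ) :
    MvPolynomial.aeval Y P = ∑ s ∈ P.support, P.coeff s • s.prod fun k n => Y k ^ n := by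
  rw [MvPolynomial.aeval_def, MvPolynomial.eval₂_eq]
  exact sum_congr rfl fun s _ => (Algebra.smul_def _ _).symm

/-- Triangularity by number of factors: among the monomials of the relation take one, `s`, with the
most factors, and read the coefficient at a `d` of exponent type `s`. Any other contributing
monomial would need more factors than `s`. -/
theorem algebraicIndependent_powerSum : AlgebraicIndependent ℚ powerSum := by
  rw [algebraicIndependent_iff]
  intro P hP
  by_contra hne
  obtain ⟨s, hs, hmax⟩ :=
    -- `Finsupp.degree` is the number of factors, not the weighted degree.
    P.support.exists_max_image Finsupp.degree (MvPolynomial.support_nonempty.2 hne)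
  obtain ⟨d, hd, hcoeff⟩ := exists_exponentType_eq_and_coeff_ne_zero s
  have h := congrArg (MvPowerSeries.coeff d) hP
  rw [aeval_eq_sum, map_sum, sum_eq_single s, map_smul, map_zero, smul_eq_mul] at h
  · exact mul_ne_zero (MvPolynomial.mem_support_iff.1 hs) hcoeff h
  · intro t ht hts
    rw [map_smul, smul_eq_mul]
    refine mul_eq_zero_of_right _ (not_not.1 fun hc => hts ?_)
    obtain ⟨h₁, h₂⟩ := card_support_le_of_coeff_ne_zero hc
    rw [← degree_exponentType, hd] at h₁ h₂
    exact (h₂ (h₁.antisymm (hmax t ht))).symm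
  · exact fun h => absurd hs h

/-! ### Coefficients of symmetric functions, partitions and the bound on dim Λⁿ -/

theorem mapDomain_weightedContent {V : Type*} [Fintype V] (w : V → ℕ+) (κ : V → ℕ+)
    (σ : Equiv.Perm ℕ+) :
    (weightedContent w κ).mapDomain σ = weightedContent w fun v => σ (κ v) := by
  rw [weightedContent, Finsupp.mapDomain_finsetSum]
  simp [weightedContent, Finsupp.mapDomain_single]

theorem exists_eq_weightedContent (d : ℕ+ →₀ ℕ) : ∃ w : d.support → ℕ+,
    exponentType d = content w ∧ d = weightedContent w Subtype.val := by
  refine ⟨_, rfl, ?_⟩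
  conv_lhs => rw [← d.sum_single]
  exact (sum_coe_sort d.support fun i => Finsupp.single i (d i)).symm

/-- A symmetric function has the same coefficient at any two monomials that differ by a permutation
of the variables. -/
theorem IsSymm.coeff_eq {f : MvPowerSeries ℕ+ ℚ} (hf : IsSymm f) {d d' : ℕ+ →₀ ℕ}
    (h : exponentType d = exponentType d') :
    MvPowerSeries.coeff d f = MvPowerSeries.coeff d' f := by
  obtain ⟨w, hw, hd⟩ := exists_eq_weightedContent d
  obtain ⟨w', hw', hd'⟩ := exists_eq_weightedContent d'
  obtain ⟨e, he⟩ := exists_equiv_of_content_eq (hw.symm.trans (h.trans hw'))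
  -- Permutations act transitively on tuples of distinct variables, so the exponent-preserving
  -- bijection `e` between the supports extends to a permutation `σ`.
  have := Equiv.Perm.isMultiplyPretransitive ℕ+ (Fintype.card d.support)
  let x : Fin (Fintype.card d.support) ↪ ℕ+ :=
    (Fintype.equivFin d.support).symm.toEmbedding.trans (Function.Embedding.subtype _)
  let y : Fin (Fintype.card d.support) ↪ ℕ+ :=
    ((Fintype.equivFin d.support).symm.trans e).toEmbedding.trans (Function.Embedding.subtype _)
  obtain ⟨σ, hσ⟩ := MulAction.exists_smul_eq (Equiv.Perm ℕ+) x y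
  have hσ' (v : d.support) : σ v = e v := by
    have := DFunLike.congr_fun hσ (Fintype.equivFin _ v)
    simpa [x, y] using this
  have hdd : d' = d.mapDomain σ := by
    conv_lhs => rw [hd']
    conv_rhs => rw [hd, mapDomain_weightedContent]
    exact (Fintype.sum_equiv e _ _ fun v => by simp only [hσ', he]).symm
  rw [hdd, isSymm_iff.1 hf]

/-- The exponent vectors of weighted degree `n`, where the variable `k` has weight `k`. -/
abbrev WeightedExponent (n : ℕ) : Type :=
  {s : ℕ+ →₀ ℕ // Finsupp.weight (fun k : ℕ+ => (k : ℕ)) s = n}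

theorem content_apply_eq_count {ι : Type*} [Fintype ι] (w : ι → ℕ+) (k : ℕ+) :
    content w k = (univ.val.map fun i => (w i : ℕ)).count (k : ℕ) := by
  classical
  rw [content_apply, Multiset.count_map, Fintype.card_subtype, card_def, filter_val]
  congr 1
  exact Multiset.filter_congr fun i _ => by rw [eq_comm, PNat.coe_inj]

theorem map_part {n : ℕ} (p : n.Partition) :
    (univ.val.map fun i => (part p i : ℕ)) = p.parts :=
  Multiset.map_univ_coe p.parts

/-- Partitions of `n` are the exponent vectors of weighted degree `n`. -/
def partitionToExponent {n : ℕ} (p : n.Partition) : WeightedExponent n :=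
  ⟨content (part p), by
    rw [weight_content]
    exact (congrArg Multiset.sum (map_part p)).trans p.parts_sum⟩

theorem bijective_partitionToExponent (n : ℕ) :
    Function.Bijective (partitionToExponent (n := n)) := by
  constructor
  · intro p q h
    have key (k : ℕ+) : p.parts.count (k : ℕ) = q.parts.count (k : ℕ) := by
      rw [← map_part p, ← map_part q, ← content_apply_eq_count, ← content_apply_eq_count]
      exact DFunLike.congr_fun (congrArg Subtype.val h) k
    refine Nat.Partition.ext (Multiset.ext.2 fun a => ?_)
    rcases a.eq_zero_or_pos with rfl | ha
    · rw [Multiset.count_eq_zero.2 fun h => (p.parts_pos h).false,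
        Multiset.count_eq_zero.2 fun h => (q.parts_pos h).false]
    · exact key ⟨a, ha⟩
  · rintro ⟨s, rfl⟩
    obtain ⟨ι, hι, w, rfl⟩ : ∃ (ι : Type) (_ : Fintype ι) (w : ι → ℕ+), content w = s :=
      ⟨_, _, _, content_sigma s⟩
    refine ⟨⟨univ.val.map fun i => (w i : ℕ), fun {i} hi => ?_, (weight_content w).symm⟩, ?_⟩
    · obtain ⟨j, -, rfl⟩ := Multiset.mem_map.1 hi
      exact (w j).pos
    · refine Subtype.ext (Finsupp.ext fun k => ?_)
      change content (part _) k = content w k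
      rw [content_apply_eq_count, map_part, content_apply_eq_count]

/-- Partitions of `n` are the exponent vectors of weighted degree `n`. -/
def partitionEquiv (n : ℕ) : n.Partition ≃ WeightedExponent n :=
  Equiv.ofBijective _ (bijective_partitionToExponent n)

instance (n : ℕ) : Fintype (WeightedExponent n) := Fintype.ofEquiv _ (partitionEquiv n)

/-- The coefficients at one monomial for each multiset of exponents, as a linear map. -/
def representativeCoeff (n : ℕ) : LamDeg n →ₗ[ℚ] (WeightedExponent n → ℚ) :=
  LinearMap.pi fun s => (MvPowerSeries.coeff
    (exists_exponentType_eq_and_coeff_ne_zero s.1).choose).comp (LamDeg n).subtype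

/-- Homogeneity kills the coefficients outside degree `n`; by symmetry every other one equals that
of the representative with the same exponent type. -/
theorem injective_representativeCoeff (n : ℕ) : Function.Injective (representativeCoeff n) := by
  rw [injective_iff_map_eq_zero]
  rintro ⟨f, hf⟩ h
  refine Subtype.ext (MvPowerSeries.ext fun d => ?_)
  by_cases hd : d.degree = n
  · have h' := congrFun h ⟨exponentType d, by rw [weight_exponentType, hd]⟩
    exact (hf.1.coeff_eq
      (exists_exponentType_eq_and_coeff_ne_zero (exponentType d)).choose_spec.1.symm).trans h'
  · exact MvPowerSeries.IsHomogeneous.coeff_eq_zero hf.2 hd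

instance (n : ℕ) : Module.Finite ℚ (LamDeg n) :=
  Module.Finite.of_injective _ (injective_representativeCoeff n)

theorem finrank_LamDeg_le (n : ℕ) :
    Module.finrank ℚ (LamDeg n) ≤ Fintype.card (WeightedExponent n) :=
  (LinearMap.finrank_le_finrank_of_injective (injective_representativeCoeff n)).trans_eq
    (Module.finrank_fintype_fun_eq_card ℚ)

/-! ### The grading of Λ and monomials in homogeneous generators -/

theorem one_mem_LamDeg : (1 : MvPowerSeries ℕ+ ℚ) ∈ LamDeg 0 := by
  classical
  refine ⟨fun σ => map_one _, fun {d} hd => ?_⟩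
  rw [MvPowerSeries.coeff_one] at hd
  simp [show d = 0 by by_contra h; simp [h] at hd]

theorem mul_mem_LamDeg {m n : ℕ} {f g : MvPowerSeries ℕ+ ℚ} (hf : f ∈ LamDeg m)
    (hg : g ∈ LamDeg n) : f * g ∈ LamDeg (m + n) :=
  ⟨fun σ => by rw [map_mul, hf.1 σ, hg.1 σ], MvPowerSeries.IsHomogeneous.mul hf.2 hg.2⟩

theorem prod_mem_LamDeg {ι : Type*} (t : Finset ι) {n : ι → ℕ} {f : ι → MvPowerSeries ℕ+ ℚ}
    (hf : ∀ i, f i ∈ LamDeg (n i)) : ∏ i ∈ t, f i ∈ LamDeg (∑ i ∈ t, n i) := by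
  classical
  induction t using Finset.induction_on with
  | empty => exact one_mem_LamDeg
  | insert a t ha ih =>
    rw [prod_insert ha, sum_insert ha]
    exact mul_mem_LamDeg (hf a) ih

theorem LamDeg_le_Lam (n : ℕ) : LamDeg n ≤ Subalgebra.toSubmodule Lam := by
  rintro f ⟨hf, hf'⟩
  exact ⟨hf, n, fun d hd => not_lt.1 fun h => hd (hf'.coeff_eq_zero h.ne')⟩

theorem homogeneousComponent_mem_LamDeg {f : MvPowerSeries ℕ+ ℚ} (hf : IsSymm f) (n : ℕ) :
    f.homogeneousComponent n ∈ LamDeg n := by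
  refine ⟨isSymm_iff.2 fun σ d => ?_, f.isHomogeneous_homogeneousComponent n⟩
  rw [MvPowerSeries.coeff_homogeneousComponent, MvPowerSeries.coeff_homogeneousComponent,
    isSymm_iff.1 hf, Finsupp.degree_mapDomain]

theorem eq_sum_homogeneousComponent {f : MvPowerSeries ℕ+ ℚ} {N : ℕ}
    (hf : ∀ d : ℕ+ →₀ ℕ, MvPowerSeries.coeff d f ≠ 0 → d.degree ≤ N) :
    f = ∑ n ∈ range (N + 1), f.homogeneousComponent n := by
  ext d
  rw [map_sum]
  simp only [MvPowerSeries.coeff_homogeneousComponent, sum_ite_eq, mem_range, Nat.lt_succ_iff]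
  split_ifs with h
  · rfl
  · exact not_not.1 (mt (hf d) h)

/-- The monomials in a sequence of symmetric functions. -/
def monomialIn (Y : ℕ+ → MvPowerSeries ℕ+ ℚ) (s : ℕ+ →₀ ℕ) : MvPowerSeries ℕ+ ℚ :=
  s.prod fun k n => Y k ^ n

theorem monomialIn_mem_adjoin (Y : ℕ+ → MvPowerSeries ℕ+ ℚ) (s : ℕ+ →₀ ℕ) :
    monomialIn Y s ∈ Algebra.adjoin ℚ (Set.range Y) :=
  prod_mem fun k _ => pow_mem (Algebra.subset_adjoin (Set.mem_range_self k)) _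


theorem monomialIn_mem_LamDeg {Y : ℕ+ → MvPowerSeries ℕ+ ℚ} (hY : ∀ k : ℕ+, Y k ∈ LamDeg (k : ℕ))
    (s : ℕ+ →₀ ℕ) : monomialIn Y s ∈ LamDeg (Finsupp.weight (fun k : ℕ+ => (k : ℕ)) s) := by
  obtain ⟨ι, hι, w, rfl⟩ : ∃ (ι : Type) (_ : Fintype ι) (w : ι → ℕ+), content w = s :=
    ⟨_, _, _, content_sigma s⟩
  rw [monomialIn, ← prod_eq_prod_content, weight_content]
  exact prod_mem_LamDeg _ fun i => hY (w i)

theorem monomialIn_mem_LamDeg' {Y : ℕ+ → MvPowerSeries ℕ+ ℚ} (hY : ∀ k : ℕ+, Y k ∈ LamDeg (k : ℕ))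
    {n : ℕ} (s : WeightedExponent n) : monomialIn Y s ∈ LamDeg n := by
  have := monomialIn_mem_LamDeg hY s.1
  rwa [s.2] at this

/-- Each monomial is homogeneous of its weight, so a polynomial expression can be cut down to its
terms of weight `n`. This turns algebraic statements about generators into linear ones in Λⁿ. -/
theorem homogeneousComponent_aeval {Y : ℕ+ → MvPowerSeries ℕ+ ℚ}
    (hY : ∀ k : ℕ+, Y k ∈ LamDeg (k : ℕ)) (n : ℕ) (P : MvPolynomial ℕ+ ℚ) :
    (MvPolynomial.aeval Y P).homogeneousComponent n =
      ∑ s ∈ P.support with Finsupp.weight (fun k : ℕ+ => (k : ℕ)) s = n,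
        P.coeff s • monomialIn Y s := by
  rw [aeval_eq_sum, map_sum, sum_filter]
  refine sum_congr rfl fun s _ => ?_
  have h : (monomialIn Y s).IsHomogeneous (Finsupp.weight (fun k : ℕ+ => (k : ℕ)) s) :=
    (monomialIn_mem_LamDeg hY s).2
  rw [map_smul]
  change P.coeff s • (monomialIn Y s).homogeneousComponent n = _
  split_ifs with hs
  · subst hs
    rw [← MvPowerSeries.isHomogeneous_iff_eq_homogeneousComponent.1 h]
  · convert smul_zero _
    ext d
    rw [MvPowerSeries.coeff_homogeneousComponent]
    split_ifs with hd
    · exact MvPowerSeries.IsHomogeneous.coeff_eq_zero h fun h' => hs (h'.symm.trans hd)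
    · rfl

theorem linearIndependent_monomialIn {Y : ℕ+ → MvPowerSeries ℕ+ ℚ}
    (hY : AlgebraicIndependent ℚ Y) : LinearIndependent ℚ (monomialIn Y) := by
  have h := (MvPolynomial.basisMonomials ℕ+ ℚ).linearIndependent.map'
    (MvPolynomial.aeval Y).toLinearMap
    (LinearMap.ker_eq_bot.2 (algebraicIndependent_iff_injective_aeval.1 hY))
  have e : monomialIn Y = (MvPolynomial.aeval Y).toLinearMap ∘ MvPolynomial.basisMonomials ℕ+ ℚ := by
    ext1 s
    simp [monomialIn, MvPolynomial.aeval_monomial]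
  rw [e]
  exact h

/-- The power sum monomials of degree `n` are linearly independent in `Λⁿ`. -/
theorem linearIndependent_powerSum (n : ℕ) :
    LinearIndependent ℚ fun s : WeightedExponent n =>
      (⟨monomialIn powerSum s, monomialIn_mem_LamDeg'
        (fun k => ⟨isSymm_powerSum k, isHomogeneous_powerSum k⟩) s⟩ : LamDeg n) :=
  LinearIndependent.of_comp (LamDeg n).subtype
    ((linearIndependent_monomialIn algebraicIndependent_powerSum).comp _ Subtype.val_injective)

theorem finrank_LamDeg (n : ℕ) :
    Fintype.card (WeightedExponent n) = Module.finrank ℚ (LamDeg n) :=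
  (linearIndependent_powerSum n).fintype_card_le_finrank.antisymm (finrank_LamDeg_le n)

/-- Bounded degree makes a symmetric function a finite sum of homogeneous components. In each degree
the power sum monomials are independent and as many as the dimension, hence span. -/
theorem adjoin_powerSum_eq_Lam : Algebra.adjoin ℚ (Set.range powerSum) = Lam := by
  apply le_antisymm
  · refine Algebra.adjoin_le ?_
    rintro _ ⟨k, rfl⟩
    exact LamDeg_le_Lam k ⟨isSymm_powerSum k, isHomogeneous_powerSum k⟩
  · rintro f ⟨hf, N, hN⟩
    rw [eq_sum_homogeneousComponent hN]
    refine sum_mem fun n _ => ?_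
    have hn : (⟨f.homogeneousComponent n, homogeneousComponent_mem_LamDeg hf n⟩ : LamDeg n) ∈
        (⊤ : Submodule ℚ (LamDeg n)) := trivial
    rw [← (linearIndependent_powerSum n).span_eq_top_of_card_eq_finrank' (finrank_LamDeg n)] at hn
    have hn' := Submodule.mem_map_of_mem (f := (LamDeg n).subtype) hn
    rw [Submodule.map_span] at hn'
    refine (Submodule.span_le (p := Subalgebra.toSubmodule
      (Algebra.adjoin ℚ (Set.range powerSum)))).2 ?_ hn'
    rintro _ ⟨_, ⟨s, rfl⟩, rfl⟩
    exact monomialIn_mem_adjoin _ _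

/-- Write `f` as a polynomial in the generators; taking its component of degree `n` leaves `f`
unchanged and discards all monomials of other weights. -/
theorem top_le_span_monomialIn {Y : ℕ+ → MvPowerSeries ℕ+ ℚ}
    (hY : ∀ k : ℕ+, Y k ∈ LamDeg (k : ℕ)) (hgen : Algebra.adjoin ℚ (Set.range Y) = Lam) (n : ℕ) :
    ⊤ ≤ Submodule.span ℚ (Set.range fun s : WeightedExponent n =>
      (⟨monomialIn Y s, monomialIn_mem_LamDeg' hY s⟩ : LamDeg n)) := by
  rintro ⟨f, hf⟩ -
  have hfL : f ∈ Lam := LamDeg_le_Lam n hf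
  rw [← hgen, Algebra.adjoin_range_eq_range_aeval] at hfL
  obtain ⟨P, hP⟩ := hfL
  have h : f = ∑ s ∈ P.support with Finsupp.weight (fun k : ℕ+ => (k : ℕ)) s = n,
      P.coeff s • monomialIn Y s := by
    rw [← homogeneousComponent_aeval hY n P]
    exact (MvPowerSeries.isHomogeneous_iff_eq_homogeneousComponent.1 hf.2).trans
      (congrArg _ hP.symm)
  rw [← sum_attach] at h
  have h' : (⟨f, hf⟩ : LamDeg n) =
      ∑ s ∈ (P.support.filter fun s => Finsupp.weight (fun k : ℕ+ => (k : ℕ)) s = n).attach,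
        P.coeff s.1 • (⟨monomialIn Y s.1, monomialIn_mem_LamDeg' hY ⟨s.1, (mem_filter.1 s.2).2⟩⟩ :
          LamDeg n) := by
    refine Subtype.ext (h.trans ?_)
    rw [AddSubmonoidClass.coe_finsetSum]
    rfl
  rw [h']
  exact sum_mem fun s _ => Submodule.smul_mem _ _
    (Submodule.subset_span ⟨⟨s.1, (mem_filter.1 s.2).2⟩, rfl⟩)

/-- A sequence of generators of `Λ`, one in each degree, gives a basis of `Λⁿ`. -/
def monomialBasis {Y : ℕ+ → MvPowerSeries ℕ+ ℚ} (hY : ∀ k : ℕ+, Y k ∈ LamDeg (k : ℕ))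
    (hgen : Algebra.adjoin ℚ (Set.range Y) = Lam) (n : ℕ) :
    Module.Basis (WeightedExponent n) ℚ (LamDeg n) :=
  basisOfTopLeSpanOfCardEqFinrank _ (top_le_span_monomialIn hY hgen n) (finrank_LamDeg n)

theorem monomialBasis_apply {Y : ℕ+ → MvPowerSeries ℕ+ ℚ} (hY : ∀ k : ℕ+, Y k ∈ LamDeg (k : ℕ))
    (hgen : Algebra.adjoin ℚ (Set.range Y) = Lam) (n : ℕ) (s : WeightedExponent n) :
    (monomialBasis hY hgen n s : MvPowerSeries ℕ+ ℚ) = monomialIn Y s := by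
  rw [monomialBasis, coe_basisOfTopLeSpanOfCardEqFinrank]

/-- If a nonzero relation contains a monomial of weight `n`, its component of degree `n` is a
nontrivial linear relation among members of a basis of Λⁿ. -/
theorem algebraicIndependent_of_adjoin_eq {Y : ℕ+ → MvPowerSeries ℕ+ ℚ}
    (hY : ∀ k : ℕ+, Y k ∈ LamDeg (k : ℕ)) (hgen : Algebra.adjoin ℚ (Set.range Y) = Lam) :
    AlgebraicIndependent ℚ Y := by
  rw [algebraicIndependent_iff]
  intro P hP
  by_contra hne
  obtain ⟨s, hs⟩ := MvPolynomial.support_nonempty.2 hne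
  set n := Finsupp.weight (fun k : ℕ+ => (k : ℕ)) s with hn
  have h := homogeneousComponent_aeval hY n P
  rw [hP, map_zero] at h
  have hli : LinearIndependent ℚ fun s : WeightedExponent n => monomialIn Y s := by
    have := (monomialBasis hY hgen n).linearIndependent.map' (LamDeg n).subtype
      (Submodule.ker_subtype _)
    have e : (fun s : WeightedExponent n => monomialIn Y s) =
        (LamDeg n).subtype ∘ monomialBasis hY hgen n :=
      funext fun s => (monomialBasis_apply hY hgen n s).symm
    rw [e]
    exact this
  have hli' : LinearIndepOn ℚ (monomialIn Y)
      {s | Finsupp.weight (fun k : ℕ+ => (k : ℕ)) s = n} := hli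
  have := linearIndepOn_iff'.1 hli' _ P.coeff (by intro; simp) h.symm s (by simp [hs, hn])
  exact MvPolynomial.mem_support_iff.1 hs this

/-! ### Weighted chromatic symmetric functions and deletion of a leaf -/

/-- The chromatic symmetric function of a graph with vertex weights: a proper colouring `κ`
contributes `∏ v, x_{κ v} ^ (w v)`. -/
def weightedCsf {V : Type*} [Fintype V] (G : SimpleGraph V) (w : V → ℕ+) : MvPowerSeries ℕ+ ℚ :=
  countSeries fun κ : G.Coloring ℕ+ => weightedContent w κ

theorem finiteFibers_coloring {V : Type*} [Fintype V] (G : SimpleGraph V) (w : V → ℕ+) :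
    FiniteFibers fun κ : G.Coloring ℕ+ => weightedContent w κ :=
  (finiteFibers_weightedContent w).comp DFunLike.coe_injective

theorem csf_eq_weightedCsf {V : Type*} [Fintype V] (G : SimpleGraph V) :
    csf G = weightedCsf G fun _ => 1 := by
  simp only [weightedCsf, weightedContent_one]
  rfl

theorem weightedContent_eq_add {V : Type*} [Fintype V] (v : V) [Fintype ({v}ᶜ : Set V)]
    (w κ : V → ℕ+) : weightedContent w κ = Finsupp.single (κ v) (w v : ℕ) +
      weightedContent (fun x : ({v}ᶜ : Set V) => w x) fun x => κ x := by
  classical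
  rw [weightedContent, Fintype.sum_eq_add_sum_compl v, weightedContent]
  congr 1
  exact (sum_subtype _ (by simp) fun x => Finsupp.single (κ x) (w x : ℕ))

theorem sum_eq_add_compl {V : Type*} [Fintype V] (v : V) [Fintype ({v}ᶜ : Set V)]
    (f : V → ℕ) : ∑ x, f x = f v + ∑ x : ({v}ᶜ : Set V), f x := by
  classical
  rw [Fintype.sum_eq_add_sum_compl v]
  congr 1
  exact (sum_subtype _ (by simp) f)

theorem finiteFibers_add {S S' : Type*} {c : S → ℕ+ →₀ ℕ} {c' : S' → ℕ+ →₀ ℕ}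
    (hc : FiniteFibers c) (hc' : FiniteFibers c') :
    FiniteFibers fun s : S × S' => c s.1 + c' s.2 := by
  classical
  intro d
  have := fun d => hc d
  have := fun d => hc' d
  refine Finite.of_injective (β := Σ q : antidiagonal d, {s // c s = q.1.1} × {s // c' s = q.1.2})
    (fun s => ⟨⟨(c s.1.1, c' s.1.2), mem_antidiagonal.2 s.2⟩, ⟨s.1.1, rfl⟩, ⟨s.1.2, rfl⟩⟩) ?_
  intro s t h
  have h₁ := congrArg (fun q : Σ q : antidiagonal d, {s // c s = q.1.1} × {s // c' s = q.1.2} =>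
    (q.2.1.1, q.2.2.1)) h
  exact Subtype.ext h₁

/-- Deletion–contraction at a leaf `v` with neighbour `u`. -/
theorem powerSum_mul_weightedCsf {V : Type*} [Fintype V] {G : SimpleGraph V} {u v : V}
    [Fintype ({v}ᶜ : Set V)] [DecidableEq ({v}ᶜ : Set V)] (huv : u ∈ ({v}ᶜ : Set V))
    (hv : ∀ x, G.Adj v x ↔ x = u) (w : V → ℕ+) :
    powerSum (w v) * weightedCsf (G.induce {v}ᶜ) (fun x => w x) =
      weightedCsf (G.induce {v}ᶜ)
        (Function.update (fun x => w x) ⟨u, huv⟩ (w v + w u)) + weightedCsf G w := by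
  classical
  -- The product counts pairs of a colour for `v` and a colouring of `G - v`. They are split by
  -- whether that colour is the one of `u`: if so, the weight of `v` is added to that of `u`; if
  -- not, the pair is a proper colouring of `G`, since `u` is the only neighbour of `v`.
  rw [powerSum, weightedCsf, countSeries_mul (finiteFibers_single _) (finiteFibers_coloring _ _),
    countSeries_split (S := ℕ+ × (G.induce {v}ᶜ).Coloring ℕ+) ?_ fun s => s.1 = s.2 ⟨u, huv⟩]
  · congr 1
    · symm
      refine countSeries_congr
        { toFun := fun κ => ⟨(κ ⟨u, huv⟩, κ), rfl⟩
          invFun := fun s => s.1.2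
          left_inv := fun κ => rfl
          right_inv := ?_ } fun κ => ?_
      · rintro ⟨⟨i, κ⟩, h⟩
        dsimp only at h
        subst h
        rfl
      · ext i
        change (Finsupp.single (κ ⟨u, huv⟩) (w v : ℕ) + weightedContent _ κ) i = _
        rw [Finsupp.add_apply, weightedContent_apply, weightedContent_apply,
          Fintype.sum_eq_add_sum_compl ⟨u, huv⟩,
          Fintype.sum_eq_add_sum_compl (⟨u, huv⟩ : ({v}ᶜ : Set V)),
          Function.update_self, Finsupp.single_apply, ← add_assoc]
        congr 1
        · split_ifs <;> simp
        · refine sum_congr rfl fun x hx => ?_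
          rw [Function.update_of_ne (by simpa using hx)]
    · symm
      let f : G.Coloring ℕ+ → {s : ℕ+ × (G.induce {v}ᶜ).Coloring ℕ+ // ¬ s.1 = s.2 ⟨u, huv⟩} :=
        fun κ => ⟨(κ v, κ.comp (SimpleGraph.Embedding.induce {v}ᶜ).toHom),
          κ.valid ((hv u).2 rfl)⟩
      refine countSeries_congr (Equiv.ofBijective f ⟨fun κ κ' h => ?_, ?_⟩) fun κ => ?_
      · have h₁ : κ v = κ' v := congrArg (fun s => s.1.1) h
        have h₂ (x : ({v}ᶜ : Set V)) : κ x = κ' x :=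
          DFunLike.congr_fun (congrArg (fun s => s.1.2) h) x
        refine DFunLike.ext _ _ fun x => ?_
        by_cases hx : x = v
        · rw [hx, h₁]
        · exact h₂ ⟨x, hx⟩
      · rintro ⟨⟨i, κ⟩, h⟩
        refine ⟨SimpleGraph.Coloring.mk
          (fun x => if hx : x = v then i else κ ⟨x, hx⟩) ?_, ?_⟩
        · intro x y hxy
          by_cases hx : x = v
          · subst hx
            obtain rfl := (hv y).1 hxy
            rw [dif_pos rfl, dif_neg (show ¬ y = x from huv)]
            exact h
          · by_cases hy : y = v
            · subst hy
              obtain rfl := (hv x).1 hxy.symm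
              rw [dif_pos rfl, dif_neg (show ¬ x = y from huv)]
              exact Ne.symm h
            · rw [dif_neg hx, dif_neg hy]
              exact κ.valid (v := ⟨x, hx⟩) (w := ⟨y, hy⟩) hxy
        · refine Subtype.ext (Prod.ext (dif_pos rfl) (DFunLike.ext _ _ fun x => ?_))
          exact dif_neg x.2
      · exact (weightedContent_eq_add v w κ).symm
  · exact finiteFibers_add (finiteFibers_single _) (finiteFibers_coloring _ _)

/-! ### Trees are triangular in the power sums -/

/-- The subalgebra generated by the power sums of degree less than `m`. -/
def powerSumBelow (m : ℕ) : Subalgebra ℚ (MvPowerSeries ℕ+ ℚ) :=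
  Algebra.adjoin ℚ (powerSum '' {j | (j : ℕ) < m})

theorem powerSumBelow_mono {m n : ℕ} (h : m ≤ n) : powerSumBelow m ≤ powerSumBelow n :=
  Algebra.adjoin_mono (Set.image_mono fun _ hj => lt_of_lt_of_le hj h)

theorem powerSum_mem_powerSumBelow {k : ℕ+} {m : ℕ} (h : (k : ℕ) < m) :
    powerSum k ∈ powerSumBelow m :=
  Algebra.subset_adjoin ⟨k, h, rfl⟩

theorem weightedCsf_of_unique {V : Type*} [Fintype V] [Unique V] (G : SimpleGraph V)
    (w : V → ℕ+) : weightedCsf G w = powerSum (w default) := by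
  refine countSeries_congr
    { toFun := fun κ => κ default
      invFun := fun i => SimpleGraph.Coloring.mk (fun _ => i)
        fun {x y} h => absurd (Subsingleton.elim x y) h.ne
      left_inv := fun κ => DFunLike.ext _ _ fun x => by rw [Subsingleton.elim x default]; rfl
      right_inv := fun i => rfl } fun κ => ?_
  rw [weightedContent, Fintype.sum_unique]
  rfl

/-- Modulo products of power sums of smaller degree, the weighted chromatic symmetric function
of a tree is a nonzero multiple of a power sum. -/
theorem exists_weightedCsf_sub_mem (n : ℕ) {V : Type*} [Fintype V] {G : SimpleGraph V}
    (hG : G.IsTree) (w : V → ℕ+) (hn : Fintype.card V = n) {m : ℕ+}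
    (hm : (m : ℕ) = ∑ v, (w v : ℕ)) :
    ∃ c : ℚ, c ≠ 0 ∧ weightedCsf G w - c • powerSum m ∈ powerSumBelow m := by
  classical
  induction n generalizing V m with
  | zero =>
    have := hG.1.nonempty
    exact absurd hn Fintype.card_ne_zero
  | succ n ih =>
    rcases subsingleton_or_nontrivial V with hV | hV
    · have := hG.1.nonempty
      obtain ⟨_⟩ := unique_iff_subsingleton_and_nonempty V |>.2 ⟨hV, this⟩
      refine ⟨1, one_ne_zero, ?_⟩
      obtain rfl : m = w default := PNat.coe_injective (by simpa using hm)
      rw [weightedCsf_of_unique, one_smul, sub_self]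
      exact zero_mem _
    · obtain ⟨v, hv⟩ := hG.exists_vert_degree_one_of_nontrivial
      obtain ⟨u, hadj, hu⟩ := SimpleGraph.degree_eq_one_iff_existsUnique_adj.1 hv
      have huv : u ∈ ({v}ᶜ : Set V) := hadj.ne'
      have hG' : (G.induce {v}ᶜ).IsTree :=
        ⟨hG.1.induce_compl_singleton_of_degree_eq_one hv, hG.2.induce _⟩
      have hcard : Fintype.card ({v}ᶜ : Set V) = n := by
        have := sum_eq_add_compl v fun _ => 1
        simp only [sum_const, card_univ, smul_eq_mul, mul_one] at this
        omega
      rw [sum_eq_add_compl v] at hm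
      have hle : (w u : ℕ) ≤ ∑ x : ({v}ᶜ : Set V), (w x : ℕ) :=
        single_le_sum (f := fun x : ({v}ᶜ : Set V) => (w x : ℕ)) (fun _ _ => Nat.zero_le _)
          (mem_univ (⟨u, huv⟩ : ({v}ᶜ : Set V)))
      have hpos := (w u).pos
      have hpos' := (w v).pos
      obtain ⟨m₁, hm₁⟩ : ∃ m₁ : ℕ+, (m₁ : ℕ) = ∑ x : ({v}ᶜ : Set V), (w x : ℕ) :=
        ⟨⟨_, hpos.trans_le hle⟩, rfl⟩
      -- Deleting `v` lowers the total weight, so this leading term is itself of lower degree and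
      -- the value of `c₁` is immaterial.
      obtain ⟨c₁, -, h₁⟩ := ih hG' (fun x => w x) hcard hm₁
      -- Contraction keeps the total weight `m`, so its leading term `c₂ • powerSum m` survives. It
      -- enters X_G with the opposite sign.
      obtain ⟨c₂, hc₂, h₂⟩ := ih hG' (Function.update (fun x => w x) ⟨u, huv⟩ (w v + w u)) hcard
        (m := m) (by
          rw [hm, Fintype.sum_eq_add_sum_compl ⟨u, huv⟩,
            Fintype.sum_eq_add_sum_compl (⟨u, huv⟩ : ({v}ᶜ : Set V)), Function.update_self,
            PNat.add_coe, add_assoc]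
          congr 2
          refine sum_congr rfl fun x hx => ?_
          rw [Function.update_of_ne (by simpa using hx)])
      refine ⟨-c₂, neg_ne_zero.2 hc₂, ?_⟩
      have key := powerSum_mul_weightedCsf huv (fun x => ⟨hu x, fun h => h ▸ hadj⟩) w
      -- Positive weights on `u` and `v` make both `m₁` and `w v` smaller than `m`, so the whole
      -- product on the left of `key` lies below degree `m`.
      have hlt : (m₁ : ℕ) < m := by omega
      have h₁' : weightedCsf (G.induce {v}ᶜ) (fun x => w x) ∈ powerSumBelow m := by
        have := add_mem (powerSumBelow_mono hlt.le h₁)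
          (Subalgebra.smul_mem _ (powerSum_mem_powerSumBelow hlt) c₁)
        rwa [sub_add_cancel] at this
      have := sub_mem (mul_mem (powerSum_mem_powerSumBelow (k := w v) (m := m) (by omega)) h₁') h₂
      rw [key] at this
      convert this using 1
      rw [neg_smul]
      abel

theorem isHomogeneous_csf {V : Type*} [Fintype V] (G : SimpleGraph V) :
    (csf G).IsHomogeneous (Fintype.card V) :=
  isHomogeneous_countSeries (c := fun κ : G.Coloring ℕ+ => content κ) fun κ => degree_content κ

/-- The triangular system is inverted by strong induction on `k`: once the lower power sums are
expressed through `X`, dividing by `c` expresses `powerSum k`. -/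
theorem adjoin_eq_Lam_of_sub_mem {X : ℕ+ → MvPowerSeries ℕ+ ℚ}
    (hX : ∀ k : ℕ+, ∃ c : ℚ, c ≠ 0 ∧ X k - c • powerSum k ∈ powerSumBelow k) :
    Algebra.adjoin ℚ (Set.range X) = Lam := by
  rw [← adjoin_powerSum_eq_Lam]
  apply le_antisymm
  · refine Algebra.adjoin_le ?_
    rintro _ ⟨k, rfl⟩
    obtain ⟨c, -, h⟩ := hX k
    have := add_mem (Algebra.adjoin_mono (Set.image_subset_range _ _) h)
      (Subalgebra.smul_mem _ (Algebra.subset_adjoin (Set.mem_range_self k)) c)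
    rwa [sub_add_cancel] at this
  · refine Algebra.adjoin_le ?_
    rintro _ ⟨k, rfl⟩
    induction k using PNat.strongInductionOn with
    | _ k ih =>
      obtain ⟨c, hc, h⟩ := hX k
      have hle : powerSumBelow k ≤ Algebra.adjoin ℚ (Set.range X) := by
        refine Algebra.adjoin_le ?_
        rintro _ ⟨j, hj, rfl⟩
        exact ih j hj
      have := Subalgebra.smul_mem _
        (sub_mem (Algebra.subset_adjoin (Set.mem_range_self k)) (hle h)) c⁻¹
      rwa [sub_sub_cancel, inv_smul_smul₀ hc] at this

/-- The chromatic symmetric function is multiplicative on disjoint unions. -/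
theorem csf_disjointUnion {ι : Type*} [Fintype ι] {W : ι → Type*} [∀ i, Fintype (W i)]
    (G : ∀ i, SimpleGraph (W i)) : csf (disjointUnion G) = ∏ i, csf (G i) := by
  have hfin (i : ι) : FiniteFibers fun κ : (G i).Coloring ℕ+ => content κ :=
    fun d => finite_coloring_content (G i) d
  refine Eq.trans ?_ (countSeries_pi hfin).symm
  refine countSeries_congr (c := fun κ : (disjointUnion G).Coloring ℕ+ => content κ)
    { toFun := fun κ i => SimpleGraph.Coloring.mk (fun a => κ ⟨i, a⟩) fun {a b} h =>
        κ.valid ((disjointUnion_adj G _ _).2 ⟨i, a, b, h, rfl, rfl⟩)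
      invFun := fun κ => SimpleGraph.Coloring.mk (fun x => κ x.1 x.2) fun {x y} h => by
        obtain ⟨i, a, b, hab, rfl, rfl⟩ := (disjointUnion_adj G _ _).1 h
        exact (κ i).valid hab
      left_inv := fun κ => rfl
      right_inv := fun κ => rfl } fun κ => ?_
  exact (Fintype.sum_sigma fun x => Finsupp.single (κ x) 1).symm

end ChromaticBases

end

/-! ### The theorem for trees -/

open ChromaticBases in
theorem mainTheorem1 {V : ℕ+ → Type*} [∀ k, Fintype (V k)] (T : ∀ k : ℕ+, SimpleGraph (V k))
    (hT : ∀ k, (T k).IsTree) (hcard : ∀ k : ℕ+, Fintype.card (V k) = (k : ℕ)) :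
    (∀ n : ℕ, ∃ b : Module.Basis n.Partition ℚ (ChromaticBases.LamDeg n),
      ∀ p : n.Partition, (b p : MvPowerSeries ℕ+ ℚ) =
        ChromaticBases.csf (ChromaticBases.partitionGraph T p)) ∧
    Algebra.adjoin ℚ (Set.range fun k : ℕ+ => ChromaticBases.csf (T k)) = ChromaticBases.Lam ∧
    AlgebraicIndependent ℚ (fun k : ℕ+ => ChromaticBases.csf (T k)) := by
  have hgen : Algebra.adjoin ℚ (Set.range fun k : ℕ+ => csf (T k)) = Lam := by
    refine adjoin_eq_Lam_of_sub_mem fun k => ?_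
    -- With all weights equal to 1 the total weight of `T k` is its number of vertices, `k`.
    rw [csf_eq_weightedCsf]
    exact exists_weightedCsf_sub_mem _ (hT k) _ rfl (by simp [hcard])
  have hdeg (k : ℕ+) : csf (T k) ∈ LamDeg (k : ℕ) := by
    -- Symmetry need not be checked on colourings: it is already contained in `hgen`.
    have h : csf (T k) ∈ Lam := hgen ▸ Algebra.subset_adjoin (Set.mem_range_self k)
    refine ⟨h.1, ?_⟩
    rw [← hcard k]
    exact isHomogeneous_csf (T k)
  refine ⟨fun n => ?_, hgen, algebraicIndependent_of_adjoin_eq hdeg hgen⟩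
  refine ⟨(monomialBasis hdeg hgen n).reindex (partitionEquiv n).symm, fun p => ?_⟩
  rw [Module.Basis.reindex_apply, Equiv.symm_symm, monomialBasis_apply, partitionGraph,
    csf_disjointUnion]
  exact (prod_eq_prod_content (part p) fun k => csf (T k)).symm
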